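/- **Definitions.** All graphs are finite. For a digraph $G=(V,E)$ write $u\leadsto_G v$ if there is a directed walk (possibly of length $0$) from $u$ to $v$, and let $d_G(u,v)$ be the length of a shortest one. The transitive closure $TC(G)$ has the edges $(u,v)$ with $u\leadsto_G v$; a transitive reduction of $G$ is a digraph $R$ on $V$ with the fewest edges such that $TC(R)=TC(G)$. A *$k$-TC-spanner* of $G$ is a digraph $H$ on $V$ all of whose edges are edges of $TC(G)$ and such that $d_H(u,v)\le k$ whenever $u\leadsto_G v$. Its size is its number of edges. A *monotone path* in a rooted tree is a subpath of a path with one endpoint at the root. A connected undirected graph $G$ is *$(s,m)$-path separable* if for every rooted spanning tree $T$ of $G$ either (1) there is a set $P$ of at most $s$ monotone paths in $T$ such that each connected component of $G\setminus P$ has at most $m$ vertices, or (2) for some $1\le s'<s$ there is a set $P$ of $s'$ monotone paths in $T$ such that the largest connected component of $G\setminus P$ is $(s-s',m)$-path separable. (Here $G\setminus P$ is $G$ with all vertices on paths of $P$ deleted.) A connected graph on $n$ vertices is *$s$-path separable* if it is $(s,n/2)$-path separable. A family $\mathcal F$ of undirected graphs is *minor-closed* if every minor of a member is a member, and *$s$-path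 separable* if each of its connected members is. A digraph $G$ is *drawn from* $\mathcal F$ if the undirected graph underlying $G$, or the one underlying some transitive reduction of $G$, belongs to $\mathcal F$. Let $A(0,j)=2j$, $A(i+1,0)=1$, $A(i+1,j+1)=A(i,A(i+1,j))$ and $B(0,j)=j^2$, $B(i+1,0)=2$, $B(i+1,j+1)=B(i,B(i+1,j))$. The $k$-th row inverse Ackermann function is $\lambda_{2i}(n)=\min\{j: A(i,j)\ge n\}$, $\lambda_{2i+1}(n)=\min\{j: B(i,j)\ge n\}$; thus $\lambda_2(n)=\lceil\log_2 n\rceil$, $\lambda_3(n)=\Theta(\log\log n)$, $\lambda_4(n)=\log^* n$. **Theorem.** Let $s$ be a natural number. 1. There is a constant $C=C(s)$ such that for every minor-closed, $s$-path separable family $\mathcal F$, every digraph $G$ on $n$ vertices drawn from $\mathcal F$ has a $2$-TC-spanner of size at most $C\, n\,(\log_2 n)^2$. 2. More generally, for every integer $k\ge 2$ there is a constant $C=C(s,k)$ such that for every minor-closed, $s$-path separable family $\mathcal F$, every digraph $G$ on $n\ge 3$ vertices drawn from $\mathcal F$ has a $k$-TC-spanner of size at most $C\, n\,\log_2 n\cdot\lambda_k(n)$.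 -/

import Mathlib

/-! ### Directed graphs: reachability, transitive reductions and TC-spanners -/

universe u v

namespace TCSpanner

/-- The number of edges of a digraph. -/
noncomputable def numEdges {V : Type u} (G : Digraph V) : ℕ :=
  {e : V × V | G.Adj e.1 e.2}.ncard

/-- There is a directed walk of length exactly `m` from `a` to `b` in `G`. -/
def WalkOfLength {V : Type u} (G : Digraph V) : ℕ → V → V → Prop
  | 0, a, b => a = b
  | m + 1, a, b => ∃ c, G.Adj a c ∧ WalkOfLength G m c b

/-- `b` is reachable from `a` in `G`, i.e. the directed distance from `a` to `b` is finite. -/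
def Reaches {V : Type u} (G : Digraph V) (a b : V) : Prop :=
  ∃ m, WalkOfLength G m a b

/-- The directed distance from `a` to `b` in `G` is at most `k`. -/
def DistLE {V : Type u} (G : Digraph V) (k : ℕ) (a b : V) : Prop :=
  ∃ m, m ≤ k ∧ WalkOfLength G m a b

/-- The transitive closure of a digraph. -/
def transClosure {V : Type u} (G : Digraph V) : Digraph V where
  Adj := Reaches G

/-- `R` is a transitive reduction of `G`: a digraph with the fewest edges among all digraphs on
the same vertices with the same transitive closure as `G`. -/
def IsTransReduction {V : Type u} (G R : Digraph V) : Prop :=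
  transClosure R = transClosure G ∧
    ∀ R' : Digraph V, transClosure R' = transClosure G → numEdges R ≤ numEdges R'

/-- `H` is a `k`-TC-spanner of `G`. -/
def IsTCSpanner {V : Type u} (k : ℕ) (G H : Digraph V) : Prop :=
  H ≤ transClosure G ∧ ∀ a b : V, Reaches G a b → DistLE H k a b

/-! ### Undirected graphs: minors and path separability -/

/-- `H` is a minor of `G`: there are pairwise disjoint connected branch sets in `G`, one for each
vertex of `H`, with an edge of `G` between the branch sets of any two adjacent vertices of `H`. -/
def IsMinor {W : Type u} {V : Type v} (H : SimpleGraph W) (G : SimpleGraph V) : Prop :=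
  ∃ B : W → Set V,
    (∀ w, (G.induce (B w)).Connected) ∧
    (∀ w w', w ≠ w' → Disjoint (B w) (B w')) ∧
    (∀ w w', H.Adj w w' → ∃ x ∈ B w, ∃ y ∈ B w', G.Adj x y)

/-- A family of undirected graphs; only its finite members are ever considered. -/
abbrev GraphFamily : Type (u + 1) := ∀ V : Type u, Set (SimpleGraph V)

/-- Every minor of a finite member of the family is again in the family (in particular the family
is closed under isomorphism). -/
def MinorClosed (F : GraphFamily.{u}) : Prop :=
  ∀ (V W : Type u) [Finite V] [Finite W] (G : SimpleGraph V) (H : SimpleGraph W),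
    G ∈ F V → IsMinor H G → H ∈ F W

/-- `S` is the vertex set of a monotone path in the tree `T` rooted at `r`, that is, of a subpath
of a path of `T` with one endpoint at the root. -/
def IsMonotonePath {V : Type u} (T : SimpleGraph V) (r : V) (S : Set V) : Prop :=
  ∃ (x : V) (p : T.Walk r x) (a b : V) (q : T.Walk a b),
    p.IsPath ∧ q.IsSubwalk p ∧ S = {w | w ∈ q.support}

/-- The graph `G \ P`: all vertices on the paths in `P` are deleted. -/
abbrev deletePaths {V : Type u} (G : SimpleGraph V) (P : Finset (Set V)) :
    SimpleGraph ((⋃₀ (P : Set (Set V)))ᶜ : Set V) :=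
  G.induce (⋃₀ (P : Set (Set V)))ᶜ

/-- `(s, m)`-path separability of a connected graph: for every rooted spanning tree `(T, r)`, either
(1) deleting some set of at most `s` monotone paths of `T` leaves only components with at most `m`
vertices, or (2) for some `s' < s`, deleting some set of `s'` monotone paths of `T` leaves a graph
whose largest component is `(s - s', m)`-path separable. In (2) we take `s' ≥ 1`, since for
`s' = 0` the clause only refers back to the `(s, m)`-path separability of the same graph.
A path is given by its vertex set, which determines it inside a rooted tree. -/
def IsPathSeparable {V : Type u} (G : SimpleGraph V) (s m : ℕ) : Prop :=
  ∀ (T : SimpleGraph V) (r : V), T ≤ G → T.IsTree →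
    (∃ P : Finset (Set V), P.card ≤ s ∧ (∀ S ∈ P, IsMonotonePath T r S) ∧
      ∀ c : (deletePaths G P).ConnectedComponent, c.supp.ncard ≤ m) ∨
    (∃ s' : ℕ, ∃ _ : 0 < s' ∧ s' < s,
      ∃ P : Finset (Set V), P.card = s' ∧ (∀ S ∈ P, IsMonotonePath T r S) ∧
        ∃ c : (deletePaths G P).ConnectedComponent,
          (∀ c' : (deletePaths G P).ConnectedComponent, c'.supp.ncard ≤ c.supp.ncard) ∧
          IsPathSeparable c.toSimpleGraph (s - s') m)
termination_by s
decreasing_by omega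

/-- A family is `s`-path separable if each of its finite connected members, on `n` vertices say,
is `(s, n / 2)`-path separable. (Component sizes are natural numbers, so `n / 2` may be rounded
down.) -/
def FamilyPathSeparable (F : GraphFamily.{u}) (s : ℕ) : Prop :=
  ∀ (V : Type u) [Finite V] (G : SimpleGraph V),
    G ∈ F V → G.Connected → IsPathSeparable G s (Nat.card V / 2)

/-- A digraph `G` is drawn from the family `F` of undirected graphs if `F` contains the underlying
undirected graph of `G` or of a transitive reduction of `G`. (For an acyclic `G` and a minor-closed
`F` the first alternative implies the second one.) -/
def DrawnFrom {V : Type u} (F : GraphFamily.{u}) (G : Digraph V) : Prop :=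
  G.toSimpleGraphInclusive ∈ F V ∨
    ∃ R : Digraph V, IsTransReduction G R ∧ R.toSimpleGraphInclusive ∈ F V

/-! ### The inverse Ackermann hierarchy of Alon and Schieber -/

/-- `A(0, j) = 2j`, `A(i + 1, 0) = 1`, `A(i + 1, j + 1) = A(i, A(i + 1, j))`;
for instance `A(1, j) = 2 ^ j`, and `A(2, j)` is a tower of twos. -/
def ackA : ℕ → ℕ → ℕ
  | 0, j => 2 * j
  | _ + 1, 0 => 1
  | i + 1, j + 1 => ackA i (ackA (i + 1) j)

/-- `B(0, j) = j ^ 2`, `B(i + 1, 0) = 2`, `B(i + 1, j + 1) = B(i, B(i + 1, j))`;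
for instance `B(1, j) = 2 ^ 2 ^ j`. -/
def ackB : ℕ → ℕ → ℕ
  | 0, j => j ^ 2
  | _ + 1, 0 => 2
  | i + 1, j + 1 => ackB i (ackB (i + 1) j)

/-- The `k`-th row inverse Ackermann function: `λ_{2i}(n)` is the least `j` with `A(i, j) ≥ n`, and
`λ_{2i+1}(n)` is the least `j` with `B(i, j) ≥ n`. Thus `λ_2(n) = ⌈log₂ n⌉`,
`λ_3(n) = ⌈log₂ log₂ n⌉` and `λ_4(n) = log* n`. -/
noncomputable def invAck (k n : ℕ) : ℕ :=
  sInf {j | n ≤ if Even k then ackA (k / 2) j else ackB (k / 2) j}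

end TCSpanner

namespace TCSpanner

/-! ### Walks -/

/-! The proof is divide and conquer along path separators, with spanners of a line as the
shortcutting device.

On a line, cutting into blocks and spanning the block starts with two fewer steps turns row `k` of
the Ackermann hierarchy into row `k + 2`; this gives size O(n λ_k(n)) (`LineSpanner.blocks`,
`exists_lineSpanner`). If a set `Q` is totally ordered by reachability, every vertex has an earliest
point of entry into `Q` and a latest point of exit from it. Sorting these points makes a line whose
spanner shortcuts all walks through `Q` (`exists_shortcuts_of_chain`).

Paths of an arbitrary spanning tree are not directed. `exists_layering` therefore grows a tree from
a root in phases that follow edges alternately forwards and backwards. Reachable pairs then lie in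
equal or adjacent layers, and a monotone path meets each layer in a chain. As a vertex matters to at
most three layers, one monotone path costs O(n λ_k(n)) edges (`exists_tree_shortcuts`).

A walk that avoids the deleted paths stays in one component (`HasSpanner.of_separator`). Deleting at
most `s` paths in all halves the components, which are again in the family, so log₂ n rounds suffice
(`HasSpanner.of_family`). -/

lemma WalkOfLength.map {V : Type*} {W : Type*} {G : Digraph V} {H : Digraph W} (f : V → W)
    (hf : ∀ x y, G.Adj x y → H.Adj (f x) (f y)) :
    ∀ {m : ℕ} {a b : V}, WalkOfLength G m a b → WalkOfLength H m (f a) (f b)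
  | 0, _, _, h => congrArg f h
  | _ + 1, _, _, ⟨c, hc, h⟩ => ⟨f c, hf _ _ hc, WalkOfLength.map f hf h⟩

lemma WalkOfLength.trans {V : Type*} {G : Digraph V} :
    ∀ {m m' : ℕ} {a b c : V}, WalkOfLength G m a b → WalkOfLength G m' b c →
      WalkOfLength G (m + m') a c
  | 0, _, _, _, _, h, h' => by
      cases h
      simpa using h'
  | m + 1, m', _, _, _, ⟨d, hd, h⟩, h' => by
      rw [Nat.add_right_comm]
      exact ⟨d, hd, h.trans h'⟩

lemma WalkOfLength.loop {V : Type*} {G : Digraph V} {a : V} (h : G.Adj a a) :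
    ∀ m : ℕ, WalkOfLength G m a a
  | 0 => rfl
  | m + 1 => ⟨a, h, WalkOfLength.loop h m⟩

lemma DistLE.map {V : Type*} {W : Type*} {G : Digraph V} {H : Digraph W} (f : V → W)
    (hf : ∀ x y, G.Adj x y → H.Adj (f x) (f y)) {k : ℕ} {a b : V} (h : DistLE G k a b) :
    DistLE H k (f a) (f b) :=
  let ⟨m, hm, hw⟩ := h
  ⟨m, hm, hw.map f hf⟩

lemma DistLE.mono {V : Type*} {G H : Digraph V} (hGH : G ≤ H) {k : ℕ} {a b : V}
    (h : DistLE G k a b) : DistLE H k a b :=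
  h.map id fun _ _ hxy => hGH hxy

lemma DistLE.cons {V : Type*} {G : Digraph V} {k : ℕ} {a b c : V} (h : G.Adj a b)
    (h' : DistLE G k b c) : DistLE G (k + 1) a c :=
  let ⟨m, hm, hw⟩ := h'
  ⟨m + 1, by omega, b, h, hw⟩

lemma DistLE.trans {V : Type*} {G : Digraph V} {k l : ℕ} {a b c : V} (h : DistLE G k a b)
    (h' : DistLE G l b c) : DistLE G (k + l) a c :=
  let ⟨m, hm, hw⟩ := h
  let ⟨m', hm', hw'⟩ := h'
  ⟨m + m', by omega, hw.trans hw'⟩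

lemma DistLE.of_adj {V : Type*} {G : Digraph V} {a b : V} (h : G.Adj a b) : DistLE G 1 a b :=
  ⟨1, le_rfl, b, h, rfl⟩

lemma DistLE.refl {V : Type*} (G : Digraph V) (k : ℕ) (a : V) : DistLE G k a a :=
  ⟨0, Nat.zero_le _, rfl⟩

lemma Reaches.refl {V : Type*} (G : Digraph V) (a : V) : Reaches G a a := ⟨0, rfl⟩

lemma Reaches.trans {V : Type*} {G : Digraph V} {a b c : V} (h : Reaches G a b)
    (h' : Reaches G b c) : Reaches G a c :=
  let ⟨_, hw⟩ := h
  let ⟨_, hw'⟩ := h'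
  ⟨_, hw.trans hw'⟩

lemma Reaches.of_adj {V : Type*} {G : Digraph V} {a b : V} (h : G.Adj a b) : Reaches G a b :=
  ⟨1, b, h, rfl⟩

/-- The digraph with a given finite set of edges. -/
def ofEdges {V : Type*} (E : Finset (V × V)) : Digraph V where
  Adj a b := (a, b) ∈ E

lemma ofEdges_mono {V : Type*} {E E' : Finset (V × V)} (h : E ⊆ E') : ofEdges E ≤ ofEdges E' :=
  fun _ _ hab => h hab

/-! ### Spanners of a line -/

/-- The line on `0, …, n - 1`, with all its edges pointing up, has a `k`-TC-spanner with at most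
`e` edges. -/
def LineSpanner (k n e : ℕ) : Prop :=
  ∃ E : Finset (ℕ × ℕ), E.card ≤ e ∧ (∀ p ∈ E, p.1 ≤ p.2) ∧
    ∀ i j, i ≤ j → j < n → DistLE (ofEdges E) k i j

lemma LineSpanner.mono {k n e n' e' : ℕ} (h : LineSpanner k n e) (hn : n' ≤ n) (he : e ≤ e') :
    LineSpanner k n' e' :=
  let ⟨E, hE, hle, hd⟩ := h
  ⟨E, hE.trans he, hle, fun i j hij hj => hd i j hij (hj.trans_le hn)⟩

lemma lineSpanner_zero {n : ℕ} (hn : n ≤ 1) (e : ℕ) : LineSpanner 0 n e := by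
  refine ⟨∅, by simp, by simp, fun i j hij hj => ?_⟩
  obtain rfl : i = j := by omega
  exact DistLE.refl _ _ _

lemma lineSpanner_of_pos {k : ℕ} (hk : 1 ≤ k) (n : ℕ) : LineSpanner k n (n * n) := by
  refine ⟨(Finset.range n ×ˢ Finset.range n).filter fun p => p.1 ≤ p.2, ?_, ?_, ?_⟩
  · exact (Finset.card_filter_le _ _).trans (by simp)
  · intro p hp
    exact (Finset.mem_filter.1 hp).2
  · intro i j hij hj
    refine ⟨1, hk, j, ?_, rfl⟩
    simp only [ofEdges, Finset.mem_filter, Finset.mem_product, Finset.mem_range]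
    omega

lemma sum_block_sizes (n m : ℕ) (b : ℕ) :
    ∑ t ∈ Finset.range b, min m (n - t * m) = min n (b * m) := by
  induction b with
  | zero => simp
  | succ b ih =>
    rw [Finset.sum_range_succ, ih, Nat.add_mul]
    omega

/-- Cut the line into blocks of size `m`, join every vertex to the first vertex of its block and
to the first vertex of the next one, and recurse on these first vertices and inside the blocks. -/
lemma LineSpanner.blocks {k m n c e : ℕ} (hm : 0 < m)
    (hin : ∀ n' ≤ m, LineSpanner (k + 2) n' (c * n')) (hout : LineSpanner k ((n - 1) / m) e) :
    LineSpanner (k + 2) n (c * n + 2 * n + e) := by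
  classical
  -- Truncated subtraction gives size zero to blocks past the end, so summing over `n` blocks is
  -- harmless.
  have hsz : ∀ t, LineSpanner (k + 2) (min m (n - t * m)) (c * min m (n - t * m)) :=
    fun t => hin _ (min_le_left _ _)
  choose I hIc hIle hId using hsz
  obtain ⟨E, hEc, hEle, hEd⟩ := hout
  set A := (Finset.range n).biUnion fun t => (I t).image fun p => (p.1 + t * m, p.2 + t * m)
  set B := (Finset.range n).image fun i => (i, (i / m + 1) * m)
  set D := (Finset.range n).image fun j => (j / m * m, j)
  -- The start of block 0 is never a hub, since a vertex leaves its block for the start of the next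
  -- one. Hence the shift by one and the count `(n - 1) / m`.
  set E' := E.image fun p => ((p.1 + 1) * m, (p.2 + 1) * m)
  have hA : A.card ≤ c * n := by
    calc A.card ≤ ∑ t ∈ Finset.range n, c * min m (n - t * m) :=
          Finset.card_biUnion_le.trans
            (Finset.sum_le_sum fun t _ => Finset.card_image_le.trans (hIc t))
      _ = c * min n (n * m) := by rw [← Finset.mul_sum, sum_block_sizes]
      _ ≤ c * n := Nat.mul_le_mul_left _ (min_le_left _ _)
  have hB : B.card ≤ n := Finset.card_image_le.trans (by simp)
  have hD : D.card ≤ n := Finset.card_image_le.trans (by simp)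
  have hE' : E'.card ≤ e := Finset.card_image_le.trans hEc
  refine ⟨A ∪ (B ∪ (D ∪ E')), ?_, ?_, ?_⟩
  · have h1 := Finset.card_union_le A (B ∪ (D ∪ E'))
    have h2 := Finset.card_union_le B (D ∪ E')
    have h3 := Finset.card_union_le D E'
    omega
  · intro p hp
    simp only [Finset.mem_union, A, B, D, E', Finset.mem_biUnion, Finset.mem_image] at hp
    rcases hp with ⟨t, _, q, hq, rfl⟩ | ⟨i, _, rfl⟩ | ⟨j, _, rfl⟩ | ⟨q, hq, rfl⟩
    · exact Nat.add_le_add_right (hIle t q hq) _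
    · exact ((Nat.div_lt_iff_lt_mul hm).1 (Nat.lt_succ_self _)).le
    · exact Nat.div_mul_le_self _ _
    · exact Nat.mul_le_mul_right _ (Nat.add_le_add_right (hEle q hq) _)
  · intro i j hij hj
    have hi' := Nat.div_add_mod' i m
    have hj' := Nat.div_add_mod' j m
    have him := Nat.mod_lt i hm
    have hjm := Nat.mod_lt j hm
    rcases (Nat.div_le_div_right hij : i / m ≤ j / m).eq_or_lt with h | h
    · have hlen : j % m < min m (n - i / m * m) := by
        rw [h]
        omega
      have hle : i % m ≤ j % m := by
        rw [h] at hi'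
        omega
      have := (hId (i / m) _ _ hle hlen).map (H := ofEdges (A ∪ (B ∪ (D ∪ E'))))
        (fun x => x + i / m * m) (fun x y hxy => by
          refine Finset.mem_union_left _ (Finset.mem_biUnion.2 ⟨i / m, ?_, ?_⟩)
          · exact Finset.mem_range.2 ((Nat.div_le_self _ _).trans_lt (hij.trans_lt hj))
          · exact Finset.mem_image.2 ⟨(x, y), hxy, rfl⟩)
      rwa [show i % m + i / m * m = i by omega,
        show j % m + i / m * m = j by rw [h]; omega] at this
    · have hjn : j / m ≤ (n - 1) / m := Nat.div_le_div_right (by omega)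
      have h0 : 1 ≤ j / m := Nat.one_le_of_lt h
      have := (hEd (i / m) (j / m - 1) (Nat.le_sub_one_of_lt h) (by omega)).map
        (H := ofEdges (A ∪ (B ∪ (D ∪ E')))) (fun x => (x + 1) * m) (fun x y hxy => by
          refine Finset.mem_union_right _ (Finset.mem_union_right _ (Finset.mem_union_right _ ?_))
          exact Finset.mem_image.2 ⟨(x, y), hxy, rfl⟩)
      rw [show j / m - 1 + 1 = j / m by omega] at this
      refine DistLE.cons ?_ (this.trans (DistLE.of_adj ?_))
      · refine Finset.mem_union_right _ (Finset.mem_union_left _ ?_)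
        exact Finset.mem_image.2 ⟨i, Finset.mem_range.2 (hij.trans_lt hj), rfl⟩
      · refine Finset.mem_union_right _ (Finset.mem_union_right _ (Finset.mem_union_left _ ?_))
        exact Finset.mem_image.2 ⟨j, Finset.mem_range.2 hj, rfl⟩

/-! ### The Ackermann hierarchy -/

/-- The function whose inverse is the `k`-th row inverse Ackermann function. -/
def ackRow (k j : ℕ) : ℕ := if Even k then ackA (k / 2) j else ackB (k / 2) j

lemma ackRow_succ (k j : ℕ) : ackRow (k + 2) (j + 1) = ackRow k (ackRow (k + 2) j) := by
  have h : (k + 2) / 2 = k / 2 + 1 := by omega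
  unfold ackRow
  rw [h]
  by_cases hk : Even k
  · have : Even (k + 2) := by simpa [Nat.even_add] using hk
    simp only [hk, this, if_true, ackA]
  · have : ¬ Even (k + 2) := by simpa [Nat.even_add] using hk
    simp only [hk, this, if_false, ackB]

lemma ackRow_zero_pos (k : ℕ) : 1 ≤ ackRow (k + 2) 0 ∧ ackRow (k + 2) 0 ≤ 2 := by
  have h : (k + 2) / 2 = k / 2 + 1 := by omega
  unfold ackRow
  rw [h]
  split_ifs <;> simp [ackA, ackB]

lemma two_mul_le_ackA : ∀ i x : ℕ, 1 ≤ x → 2 * x ≤ ackA i x := by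
  intro i
  induction i with
  | zero => intro x _; simp [ackA]
  | succ i ih =>
    intro x hx
    induction x, hx using Nat.le_induction with
    | base => simpa [ackA] using ih 1 le_rfl
    | succ x hx ihx =>
      have := ih (ackA (i + 1) x) (by omega)
      simp only [ackA]
      omega

lemma two_mul_le_ackB : ∀ i x : ℕ, 2 ≤ x → 2 * x ≤ ackB i x := by
  intro i
  induction i with
  | zero => intro x hx; simp only [ackB]; nlinarith
  | succ i ih =>
    -- This stronger bound already holds at `x = 0` and keeps the inner argument at least 2, as `ih`
    -- requires.
    have h : ∀ x, 2 * (x + 1) ≤ ackB (i + 1) x := by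
      intro x
      induction x with
      | zero => simp [ackB]
      | succ x ihx =>
        have := ih (ackB (i + 1) x) (by omega)
        simp only [ackB]
        omega
    intro x _
    have := h x
    omega

lemma two_le_ackB (i x : ℕ) : 2 ≤ ackB (i + 1) x := by
  induction x with
  | zero => simp [ackB]
  | succ x ih =>
    have := two_mul_le_ackB i _ ih
    simp only [ackB]
    omega

lemma one_le_ackA (i x : ℕ) : 1 ≤ ackA (i + 1) x := by
  induction x with
  | zero => simp [ackA]
  | succ x ih =>
    have := two_mul_le_ackA i _ ih
    simp only [ackA]
    omega

lemma two_mul_ackRow_le (k j : ℕ) : 2 * ackRow (k + 2) j ≤ ackRow (k + 2) (j + 1) := by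
  have h : (k + 2) / 2 = k / 2 + 1 := by omega
  unfold ackRow
  rw [h]
  split_ifs
  · simp only [ackA]
    exact two_mul_le_ackA (k / 2) _ (one_le_ackA _ _)
  · simp only [ackB]
    exact two_mul_le_ackB (k / 2) _ (two_le_ackB _ _)

lemma two_pow_le_ackRow (k j : ℕ) : 2 ^ j ≤ ackRow (k + 2) j := by
  induction j with
  | zero => exact (ackRow_zero_pos k).1
  | succ j ih =>
    have := two_mul_ackRow_le k j
    rw [pow_succ]
    omega

/-- Blocks of size `ackRow (k + 2) j` reduce index `j + 1` to index `j`, so each increment of `j`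
adds only `(D + 2) * n` edges. -/
lemma exists_lineSpanner_of_skeleton {k D : ℕ}
    (hD : ∀ m n, 0 < m → m < n → n ≤ ackRow k m → LineSpanner k ((n - 1) / m) (D * n)) :
    ∃ C, ∀ j n, n ≤ ackRow (k + 2) j → LineSpanner (k + 2) n (C * (j + 1) * n) := by
  refine ⟨D + 2, fun j => ?_⟩
  induction j with
  | zero =>
    intro n hn
    have hn2 := hn.trans (ackRow_zero_pos k).2
    exact (lineSpanner_of_pos (by omega) n).mono le_rfl
      (Nat.mul_le_mul_right _ (by omega))
  | succ j ih =>
    intro n hn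
    rw [ackRow_succ] at hn
    rcases le_or_gt n (ackRow (k + 2) j) with h | h
    · exact (ih n h).mono le_rfl (Nat.mul_le_mul_right _ (Nat.mul_le_mul_left _ (by omega)))
    · have hpos : 0 < ackRow (k + 2) j := (Nat.two_pow_pos j).trans_le (two_pow_le_ackRow k j)
      refine (LineSpanner.blocks hpos ih (hD _ n hpos h hn)).mono le_rfl (le_of_eq ?_)
      ring

/-- The factor `m + 1` in the cost per hub is cancelled because there are only about `n / m` hubs.
-/
lemma exists_skeleton_of_lineSpanner {k C : ℕ}
    (hC : ∀ j n, n ≤ ackRow k j → LineSpanner k n (C * (j + 1) * n)) :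
    ∃ D, ∀ m n, 0 < m → m < n → n ≤ ackRow k m → LineSpanner k ((n - 1) / m) (D * n) := by
  refine ⟨C * 2, fun m n hm _ hn => ?_⟩
  have h1 : (n - 1) / m ≤ n := (Nat.div_le_self _ _).trans (Nat.sub_le _ _)
  refine (hC m _ (h1.trans hn)).mono le_rfl ?_
  have h2 : (n - 1) / m * m ≤ n := (Nat.div_mul_le_self _ _).trans (Nat.sub_le _ _)
  calc C * (m + 1) * ((n - 1) / m) ≤ C * (2 * m) * ((n - 1) / m) :=
        Nat.mul_le_mul_right _ (Nat.mul_le_mul_left _ (by omega))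
    _ = C * 2 * ((n - 1) / m * m) := by ring
    _ ≤ C * 2 * n := Nat.mul_le_mul_left _ h2

/-- The line on `n` vertices has a `k`-TC-spanner of size `O(n λ_k(n))`. -/
theorem exists_lineSpanner (k : ℕ) :
    ∃ C, ∀ j n, n ≤ ackRow (k + 2) j → LineSpanner (k + 2) n (C * (j + 1) * n) := by
  induction k using Nat.strong_induction_on with
  | _ k ih =>
    match k with
    | 0 =>
      -- Here `n ≤ 2 * m`, so at most one hub remains and no edges are needed.
      refine exists_lineSpanner_of_skeleton (D := 0) fun m n hm _ hn => lineSpanner_zero ?_ _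
      have hn : n ≤ 2 * m := by simpa [ackRow, ackA] using hn
      refine Nat.lt_succ_iff.1 ((Nat.div_lt_iff_lt_mul hm).2 ?_)
      omega
    | 1 =>
      -- Here `n ≤ m ^ 2`, so there are at most `m` hubs and joining all pairs costs at most `n`
      -- edges.
      refine exists_lineSpanner_of_skeleton (D := 1) fun m n hm _ hn =>
        (lineSpanner_of_pos le_rfl _).mono le_rfl ?_
      have hn : n ≤ m ^ 2 := by simpa [ackRow, ackB] using hn
      have h1 : (n - 1) / m * m ≤ n := (Nat.div_mul_le_self _ _).trans (Nat.sub_le _ _)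
      have h2 : (n - 1) / m ≤ m := Nat.div_le_of_le_mul (by nlinarith [Nat.sub_le n 1])
      have h3 := Nat.mul_le_mul_left ((n - 1) / m) h2
      omega
    | k + 2 =>
      obtain ⟨C, hC⟩ := ih k (by omega)
      obtain ⟨D, hD⟩ := exists_skeleton_of_lineSpanner hC
      exact exists_lineSpanner_of_skeleton hD

/-! ### Shortcutting through a chain -/

/-- The edges of `E` shortcut, with at most `k` steps, all pairs joined by a walk of `G` that
meets `Q`, whose ends are in `W`. -/
def Shortcuts {V : Type*} (k : ℕ) (G : Digraph V) (Q W : Set V) (E : Finset (V × V)) : Prop :=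
  (∀ e ∈ E, Reaches G e.1 e.2) ∧
    ∀ a ∈ W, ∀ b ∈ W, ∀ q ∈ Q, Reaches G a q → Reaches G q b → DistLE (ofEdges E) k a b

/-- Transport of a line spanner: position `i` of the line stands for the vertex `β i`, which is
only used at the ends of a walk, and for the hub `α i`. -/
lemma LineSpanner.transport {V : Type*} {G : Digraph V} {k n e : ℕ} (h : LineSpanner k n e)
    (α β : ℕ → V) :
    ∃ E : Finset (V × V), (∀ p ∈ E, Reaches G p.1 p.2) ∧ E.card ≤ 4 * e ∧
      ∀ i j, i < j → j < n →
        (∀ i' j', i' ≤ j' → j' < n → Reaches G (α i') (α j')) →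
        Reaches G (β i) (α i) → Reaches G (α j) (β j) → DistLE (ofEdges E) k (β i) (β j) := by
  classical
  obtain ⟨L, hLc, hLle, hLd⟩ := h
  -- Each end of a line edge may stand for a hub or a vertex: four lifts, hence `4 * e`. The filter
  -- drops lifts that are not in the transitive closure.
  let E₀ (f g : ℕ → V) : Finset (V × V) := L.image fun p => (f p.1, g p.2)
  have hE₀ : ∀ f g, (E₀ f g).card ≤ e := fun f g => Finset.card_image_le.trans hLc
  set E := ((E₀ α α ∪ E₀ α β) ∪ (E₀ β α ∪ E₀ β β)).filter fun p => Reaches G p.1 p.2 with hE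
  have hmem : ∀ x y, (x, y) ∈ L →
      (Reaches G (α x) (α y) → (α x, α y) ∈ E) ∧ (Reaches G (α x) (β y) → (α x, β y) ∈ E) ∧
      (Reaches G (β x) (α y) → (β x, α y) ∈ E) ∧ (Reaches G (β x) (β y) → (β x, β y) ∈ E) := by
    intro x y hxy
    simp only [hE, Finset.mem_filter, Finset.mem_union, E₀, Finset.mem_image]
    exact ⟨fun h => ⟨.inl (.inl ⟨_, hxy, rfl⟩), h⟩, fun h => ⟨.inl (.inr ⟨_, hxy, rfl⟩), h⟩,
      fun h => ⟨.inr (.inl ⟨_, hxy, rfl⟩), h⟩, fun h => ⟨.inr (.inr ⟨_, hxy, rfl⟩), h⟩⟩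
  refine ⟨E, fun p hp => (Finset.mem_filter.1 hp).2, ?_, ?_⟩
  · have h1 := Finset.card_union_le (E₀ α α ∪ E₀ α β) (E₀ β α ∪ E₀ β β)
    have h2 := Finset.card_union_le (E₀ α α) (E₀ α β)
    have h3 := Finset.card_union_le (E₀ β α) (E₀ β β)
    have h4 := hE₀ α α
    have h5 := hE₀ α β
    have h6 := hE₀ β α
    have h7 := hE₀ β β
    exact (Finset.card_filter_le _ _).trans (by omega)
  · intro i j hij hj hα hi hjb
    have hle : ∀ (m i' j' : ℕ), WalkOfLength (ofEdges L) m i' j' → i' ≤ j' := by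
      intro m
      induction m with
      | zero => exact fun i' j' hw => le_of_eq hw
      | succ m ih =>
        rintro i' j' ⟨c, hc, hw⟩
        exact (hLle _ hc).trans (ih _ _ hw)
    -- The walk runs on hubs until it lands on `β j`. As `L` may contain loops, it can arrive early;
    -- the remaining steps are then loops at `β j`.
    have hub : ∀ (m i' : ℕ), i' < j → WalkOfLength (ofEdges L) m i' j →
        WalkOfLength (ofEdges E) m (α i') (β j) := by
      intro m
      induction m with
      | zero =>
        intro i' hi' hw
        exact absurd hw hi'.ne
      | succ m ih =>
        rintro i' hi' ⟨c, hc, hw⟩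
        rcases (hle _ _ _ hw).eq_or_lt with rfl | hcj
        · cases m with
          | zero =>
            exact ⟨_, (hmem _ _ hc).2.1 ((hα _ _ hi'.le hj).trans hjb), rfl⟩
          | succ m =>
            obtain ⟨d, hd, hw'⟩ := hw
            obtain rfl : c = d := le_antisymm (hLle _ hd) (hle _ _ _ hw')
            exact ⟨β c, (hmem _ _ hc).2.1 ((hα _ _ hi'.le hj).trans hjb),
              WalkOfLength.loop ((hmem _ _ hd).2.2.2 (Reaches.refl _ _)) _⟩
        · exact ⟨_, (hmem _ _ hc).1 (hα _ _ (hLle _ hc) (hcj.trans hj)), ih _ hcj hw⟩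
    obtain ⟨m, hm, hw⟩ := hLd i j hij.le hj
    refine ⟨m, hm, ?_⟩
    cases m with
    | zero => exact absurd hw hij.ne
    | succ m =>
      obtain ⟨c, hc, hw⟩ := hw
      rcases (hle _ _ _ hw).eq_or_lt with rfl | hcj
      · refine ⟨β c, (hmem _ _ hc).2.2.2 ((hi.trans (hα _ _ hij.le hj)).trans hjb), ?_⟩
        cases m with
        | zero => rfl
        | succ m =>
          obtain ⟨d, hd, hw'⟩ := hw
          obtain rfl : c = d := le_antisymm (hLle _ hd) (hle _ _ _ hw')
          exact WalkOfLength.loop ((hmem _ _ hd).2.2.2 (Reaches.refl _ _)) _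
      · exact ⟨_, (hmem _ _ hc).2.2.1 (hi.trans (hα _ _ (hLle _ hc) (hcj.trans hj))),
          hub _ _ hcj hw⟩

/-- Counting the elements of `Q` that reach a point works even with cycles: mutually reachable
points share a position. -/
lemma exists_position {V : Type*} [Finite V] (G : Digraph V) (Q : Set V)
    (hQ : ∀ x ∈ Q, ∀ y ∈ Q, Reaches G x y ∨ Reaches G y x) :
    ∃ pos : V → ℕ, ∀ x ∈ Q, ∀ y ∈ Q, Reaches G x y ↔ pos x ≤ pos y := by
  refine ⟨fun q => {x | x ∈ Q ∧ Reaches G x q}.ncard, fun x hx y hy => ⟨fun h => ?_, fun h => ?_⟩⟩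
  · exact Set.ncard_le_ncard (fun z hz => ⟨hz.1, hz.2.trans h⟩) (Set.toFinite _)
  · by_contra hxy
    have hyx := (hQ x hx y hy).resolve_left hxy
    refine absurd h (not_le.2 (Set.ncard_lt_ncard ?_ (Set.toFinite _)))
    refine ⟨fun z hz => ⟨hz.1, hz.2.trans hyx⟩, fun hsub => hxy (hsub ⟨hx, Reaches.refl _ _⟩).2⟩

lemma exists_sorted_enumeration {I : Type*} [Fintype I] (key : I → ℕ) :
    ∃ f : Fin (Fintype.card I) ≃ I, ∀ i j, i ≤ j → key (f i) ≤ key (f j) :=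
  ⟨(Tuple.sort (key ∘ (Fintype.equivFin I).symm)).trans (Fintype.equivFin I).symm,
    fun _ _ hij => Tuple.monotone_sort (key ∘ (Fintype.equivFin I).symm) hij⟩

/-- A line spanner gives shortcuts through a set that is totally ordered by reachability. -/
lemma exists_shortcuts_of_chain {V : Type*} [Finite V] {G : Digraph V} {Q : Set V}
    (hQ : ∀ x ∈ Q, ∀ y ∈ Q, Reaches G x y ∨ Reaches G y x) (W : Finset V) {k e : ℕ}
    (h : LineSpanner k (2 * W.card) e) :
    ∃ E : Finset (V × V), Shortcuts k G Q W E ∧ E.card ≤ 4 * e := by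
  classical
  rcases Q.eq_empty_or_nonempty with rfl | ⟨q₀, hq₀⟩
  · exact ⟨∅, ⟨by simp, by simp⟩, by simp⟩
  obtain ⟨pos, hpos⟩ := exists_position G Q hQ
  have hentry : ∀ u, ∃ x ∈ Q, ∀ q ∈ Q, Reaches G u q → Reaches G u x ∧ pos x ≤ pos q := by
    intro u
    by_cases hu : ∃ q ∈ Q, Reaches G u q
    · obtain ⟨x, hx, hmin⟩ := Set.exists_min_image {q | q ∈ Q ∧ Reaches G u q} pos
        (Set.toFinite _) hu
      exact ⟨x, hx.1, fun q hq hr => ⟨hx.2, hmin q ⟨hq, hr⟩⟩⟩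
    · exact ⟨q₀, hq₀, fun q hq hr => absurd ⟨q, hq, hr⟩ hu⟩
  have hexit : ∀ u, ∃ x ∈ Q, ∀ q ∈ Q, Reaches G q u → Reaches G x u ∧ pos q ≤ pos x := by
    intro u
    by_cases hu : ∃ q ∈ Q, Reaches G q u
    · obtain ⟨x, hx, hmax⟩ := Set.exists_max_image {q | q ∈ Q ∧ Reaches G q u} pos
        (Set.toFinite _) hu
      exact ⟨x, hx.1, fun q hq hr => ⟨hx.2, hmax q ⟨hq, hr⟩⟩⟩
    · exact ⟨q₀, hq₀, fun q hq hr => absurd ⟨q, hq, hr⟩ hu⟩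
  choose s hsQ hs using hentry
  choose t htQ ht using hexit
  let hub : W × Bool → V := fun x => if x.2 then t x.1 else s x.1
  have hhub : ∀ x, hub x ∈ Q := by
    rintro ⟨x, _ | _⟩
    exacts [hsQ _, htQ _]
  -- Each vertex of `W` occurs twice, once with its entry and once with its exit. The `+ 1` puts
  -- entries before exits at equal positions, so walks through a single hub still go up the line.
  obtain ⟨f, hf⟩ := exists_sorted_enumeration
    fun x : W × Bool => 2 * pos (hub x) + if x.2 then 1 else 0
  have hcard : Fintype.card (W × Bool) = 2 * W.card := by
    simp [mul_comm]
  let α : ℕ → V := fun i => if hi : i < Fintype.card (W × Bool) then hub (f ⟨i, hi⟩) else q₀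
  let β : ℕ → V := fun i => if hi : i < Fintype.card (W × Bool) then (f ⟨i, hi⟩).1 else q₀
  obtain ⟨E, hER, hEc, hEd⟩ := h.transport (G := G) α β
  have hα : ∀ i, α (f.symm i) = hub i := by
    intro i
    simp only [α, Fin.is_lt, dif_pos, Fin.eta, Equiv.apply_symm_apply]
  have hβ : ∀ i, β (f.symm i) = i.1 := by
    intro i
    simp only [β, Fin.is_lt, dif_pos, Fin.eta, Equiv.apply_symm_apply]
  refine ⟨E, ⟨hER, fun a ha b hb q hq haq hqb => ?_⟩, hEc⟩
  set i : W × Bool := (⟨a, ha⟩, false) with hi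
  set j : W × Bool := (⟨b, hb⟩, true) with hj
  have hij : f.symm i < f.symm j := by
    by_contra hcon
    have := hf _ _ (not_lt.1 hcon)
    simp only [Equiv.apply_symm_apply, hi, hj, hub, if_true, Bool.false_eq_true, if_false] at this
    have h1 := (hs a q hq haq).2
    have h2 := (ht b q hq hqb).2
    omega
  have := hEd (f.symm i) (f.symm j) hij (by omega) (fun i' j' hij' hj' => ?_) ?_ ?_
  · rwa [hβ, hβ] at this
  · have hj'' : j' < Fintype.card (W × Bool) := by omega
    have hi'' : i' < Fintype.card (W × Bool) := by omega
    simp only [α, hi'', hj'', dif_pos]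
    refine (hpos _ (hhub _) _ (hhub _)).2 ?_
    have := hf ⟨i', hi''⟩ ⟨j', hj''⟩ hij'
    split_ifs at this <;> omega
  · rw [hα, hβ]
    exact (hs a q hq haq).1
  · rw [hα, hβ]
    exact (ht b q hq hqb).1

/-! ### Trees given by parents -/

/-- The graph that joins every vertex but the root to its parent. -/
def parentGraph {V : Type*} (r : V) (p : V → V) : SimpleGraph V :=
  SimpleGraph.fromRel fun v w => v ≠ r ∧ w = p v

lemma parentGraph_adj {V : Type*} {α : Type*} [LinearOrder α]
    {r : V} {p : V → V} {ρ : V → α} (hρ : ∀ v, v ≠ r → ρ (p v) < ρ v) {v : V} (hv : v ≠ r) :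
    (parentGraph r p).Adj v (p v) := by
  rw [parentGraph, SimpleGraph.fromRel_adj]
  refine ⟨fun h => (hρ v hv).ne (congrArg ρ h.symm), .inl ⟨hv, rfl⟩⟩

/-- From every vertex some walk to the root only uses iterated parents. -/
lemma exists_walk_to_root {V : Type*} {α : Type*} [LinearOrder α] [WellFoundedLT α]
    {r : V} {p : V → V} {ρ : V → α} (hρ : ∀ v, v ≠ r → ρ (p v) < ρ v) (x : V) :
    ∃ q : (parentGraph r p).Walk x r, ∀ y ∈ q.support, ∃ m, p^[m] x = y := by
  induction hx : ρ x using WellFoundedLT.induction generalizing x with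
  | _ a ih =>
    subst hx
    by_cases h : x = r
    · subst h
      exact ⟨.nil, fun y hy => ⟨0, (List.mem_singleton.1 hy).symm⟩⟩
    · obtain ⟨q, hq⟩ := ih _ (hρ x h) (p x) rfl
      refine ⟨.cons (parentGraph_adj hρ h) q, fun y hy => ?_⟩
      rw [SimpleGraph.Walk.support_cons, List.mem_cons] at hy
      rcases hy with rfl | hy
      · exact ⟨0, rfl⟩
      · obtain ⟨m, rfl⟩ := hq y hy
        exact ⟨m + 1, rfl⟩

/-- Descending rank leads every vertex to the root, and the edges are indexed by the vertices other
than `r`, so there are at most `|V| - 1` of them. -/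
lemma parentGraph_isTree {V : Type*} {α : Type*} [LinearOrder α] [WellFoundedLT α]
    {r : V} {p : V → V} {ρ : V → α} (hρ : ∀ v, v ≠ r → ρ (p v) < ρ v)
    [Finite V] : (parentGraph r p).IsTree := by
  have hc : (parentGraph r p).Connected :=
    { preconnected := fun x y =>
        (exists_walk_to_root hρ x).choose.reachable.trans
          (exists_walk_to_root hρ y).choose.reachable.symm
      nonempty := ⟨r⟩ }
  refine SimpleGraph.isTree_iff_connected_and_card.2 ⟨hc, le_antisymm ?_
    hc.card_vert_le_card_edgeSet_add_one⟩
  have hsub : (parentGraph r p).edgeSet ⊆ (fun v => s(v, p v)) '' {r}ᶜ := by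
    intro e
    induction e with
    | _ v w =>
      rw [SimpleGraph.mem_edgeSet, parentGraph, SimpleGraph.fromRel_adj]
      rintro ⟨_, ⟨hv, rfl⟩ | ⟨hw, rfl⟩⟩
      · exact ⟨v, hv, rfl⟩
      · exact ⟨w, hw, Sym2.eq_swap⟩
  have h1 : Nat.card (parentGraph r p).edgeSet ≤ ({r}ᶜ : Set V).ncard := by
    rw [Nat.card_coe_set_eq]
    exact (Set.ncard_le_ncard hsub (Set.toFinite _)).trans (Set.ncard_image_le (Set.toFinite _))
  have h2 := Set.ncard_add_ncard_compl ({r} : Set V)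
  rw [Set.ncard_singleton] at h2
  omega

/-- Two vertices of a monotone path are ancestors of one another. -/
lemma IsMonotonePath.exists_iterate {V : Type*} {α : Type*} [LinearOrder α] [WellFoundedLT α]
    {r : V} {p : V → V} {ρ : V → α} (hρ : ∀ v, v ≠ r → ρ (p v) < ρ v)
    [Finite V] {S : Set V}
    (hS : IsMonotonePath (parentGraph r p) r S) {y z : V} (hy : y ∈ S) (hz : z ∈ S) :
    ∃ m, p^[m] y = z ∨ p^[m] z = y := by
  classical
  obtain ⟨x, w, a, b, q, hw, hq, rfl⟩ := hS
  obtain ⟨w', hw'⟩ := exists_walk_to_root hρ x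
  have hsup : ∀ y ∈ q.support, ∃ m, p^[m] x = y := by
    intro y hy
    have h1 := hq.support_subset hy
    -- Paths in a tree are unique, so the root path consists of iterated parents of `x`.
    have h2 : (⟨w, hw⟩ : (parentGraph r p).Path r x) = w'.reverse.toPath :=
      ((parentGraph_isTree hρ).isAcyclic.subsingleton_path _ _).elim _ _
    have h3 : w = w'.reverse.bypass := congrArg Subtype.val h2
    rw [h3] at h1
    have h4 := w'.reverse.support_bypass_subset_support h1
    rw [SimpleGraph.Walk.support_reverse, List.mem_reverse] at h4
    exact hw' y h4
  obtain ⟨m, rfl⟩ := hsup y hy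
  obtain ⟨l, rfl⟩ := hsup z hz
  rcases le_total m l with h | h
  · exact ⟨l - m, .inl (by rw [← Function.iterate_add_apply, Nat.sub_add_cancel h])⟩
  · exact ⟨m - l, .inr (by rw [← Function.iterate_add_apply, Nat.sub_add_cancel h])⟩

/-! ### Layerings -/

/-- `Label G r i m v`: the vertex `v` can be reached from `r` by a walk that uses edges forwards in
its even phases and backwards in its odd phases, and is at step `m` of phase `i`. -/
inductive Label {V : Type*} (G : Digraph V) (r : V) : ℕ → ℕ → V → Prop
  | root : Label G r 0 0 r
  | up {i m : ℕ} {v : V} : Label G r i m v → Label G r (i + 1) 0 v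
  | forward {i m : ℕ} {v w : V} : Even i → Label G r i m v → G.Adj v w → Label G r i (m + 1) w
  | backward {i m : ℕ} {v w : V} : ¬ Even i → Label G r i m v → G.Adj w v → Label G r i (m + 1) w

lemma Label.exists_of_reaches {V : Type*} {G : Digraph V} {r : V} {i : ℕ} (hi : Even i) :
    ∀ {l m : ℕ} {v w : V}, Label G r i m v → WalkOfLength G l v w → ∃ m', Label G r i m' w
  | 0, m, _, _, h, hw => by
      cases hw
      exact ⟨m, h⟩
  | _ + 1, _, _, _, h, ⟨_, hc, hw⟩ => Label.exists_of_reaches hi (.forward hi h hc) hw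

lemma Label.exists_of_reaches_backward {V : Type*} {G : Digraph V} {r : V} {i : ℕ}
    (hi : ¬ Even i) :
    ∀ {l m : ℕ} {v w : V}, Label G r i m w → WalkOfLength G l v w → ∃ m', Label G r i m' v
  | 0, m, _, _, h, hw => by
      cases hw
      exact ⟨m, h⟩
  | _ + 1, _, _, _, h, ⟨_, hc, hw⟩ =>
      let ⟨_, h'⟩ := Label.exists_of_reaches_backward hi h hw
      ⟨_, .backward hi h' hc⟩

/-- Of two consecutive phases, one follows edges forwards and the other backwards. -/
lemma Label.exists_next_of_reaches {V : Type*} {G : Digraph V} {r : V} {i m : ℕ} {v w : V}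
    (h : Label G r i m v) (hvw : Reaches G v w ∨ Reaches G w v) :
    ∃ m', Label G r (i + 1) m' w := by
  rcases hvw with ⟨l, hw⟩ | ⟨l, hw⟩ <;> by_cases hi : Even i
  · obtain ⟨m', h'⟩ := h.exists_of_reaches hi hw
    exact ⟨0, h'.up⟩
  · exact h.up.exists_of_reaches (by simpa [Nat.even_add_one] using hi) hw
  · exact h.up.exists_of_reaches_backward (by simpa [Nat.even_add_one] using hi) hw
  · obtain ⟨m', h'⟩ := h.exists_of_reaches_backward hi hw
    exact ⟨0, h'.up⟩

/-- A connected digraph has a rooted spanning tree and a partition into layers such that walks only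
join vertices of equal or consecutive layers, and each monotone path of the tree meets each layer
in a chain. -/
lemma exists_layering {V : Type*} [Finite V] {G : Digraph V}
    (hG : G.toSimpleGraphInclusive.Connected) :
    ∃ (T : SimpleGraph V) (r : V) (ℓ : V → ℕ), T ≤ G.toSimpleGraphInclusive ∧ T.IsTree ∧
      (∀ a b, Reaches G a b → ℓ b ≤ ℓ a + 1 ∧ ℓ a ≤ ℓ b + 1) ∧
      ∀ S, IsMonotonePath T r S → ∀ i, ∀ x ∈ S ∩ ℓ ⁻¹' {i}, ∀ y ∈ S ∩ ℓ ⁻¹' {i},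
        Reaches G x y ∨ Reaches G y x := by
  classical
  obtain ⟨r⟩ := hG.nonempty
  have hex : ∀ v, ∃ i m, Label G r i m v := by
    intro v
    obtain ⟨w⟩ := hG.preconnected v r
    induction w with
    | nil => exact ⟨0, 0, .root⟩
    | cons hadj _ ih =>
      obtain ⟨i, m, h⟩ := ih
      rw [Digraph.toSimpleGraphInclusive, SimpleGraph.fromRel_adj] at hadj
      obtain ⟨m', h'⟩ := h.exists_next_of_reaches (hadj.2.symm.imp .of_adj .of_adj)
      exact ⟨_, _, h'⟩
  let ℓ : V → ℕ := fun v => Nat.find (hex v)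
  have hex' : ∀ v, ∃ m, Label G r (ℓ v) m v := fun v => Nat.find_spec (hex v)
  let δ : V → ℕ := fun v => Nat.find (hex' v)
  have hlab : ∀ v, Label G r (ℓ v) (δ v) v := fun v => Nat.find_spec (hex' v)
  have hℓ : ∀ {i m v}, Label G r i m v → ℓ v ≤ i := fun h => Nat.find_min' (hex _) ⟨_, h⟩
  have hδ : ∀ {m v}, Label G r (ℓ v) m v → δ v ≤ m := fun h => Nat.find_min' (hex' _) h
  -- The parent is the previous vertex of a lexicographically least label. Such a label cannot end
  -- with `up`, which would allow a smaller phase, so it ends with an edge whose direction is set by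
  -- the parity of `ℓ v`.
  have hpar : ∀ v, ∃ w, v ≠ r → (ℓ w < ℓ v ∨ ℓ w = ℓ v ∧ δ w < δ v) ∧
      (Even (ℓ v) ∧ G.Adj w v ∨ ¬ Even (ℓ v) ∧ G.Adj v w) := by
    intro v
    by_cases hv : v = r
    · exact ⟨v, fun h => absurd hv h⟩
    have key : ∀ i m, Label G r i m v → i = ℓ v → m = δ v →
        ∃ w, (ℓ w < ℓ v ∨ ℓ w = ℓ v ∧ δ w < δ v) ∧
          (Even (ℓ v) ∧ G.Adj w v ∨ ¬ Even (ℓ v) ∧ G.Adj v w) := by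
      intro i m h
      cases h with
      | root => exact absurd rfl hv
      | up h =>
        intro hi _
        have := hℓ h
        omega
      | @forward _ m w _ hi h hadj =>
        rintro rfl hm
        refine ⟨w, ?_, .inl ⟨hi, hadj⟩⟩
        rcases (hℓ h).lt_or_eq with hlt | heq
        · exact .inl hlt
        · have := hδ (heq ▸ h)
          exact .inr ⟨heq, by omega⟩
      | @backward _ m w _ hi h hadj =>
        rintro rfl hm
        refine ⟨w, ?_, .inr ⟨hi, hadj⟩⟩
        rcases (hℓ h).lt_or_eq with hlt | heq
        · exact .inl hlt
        · have := hδ (heq ▸ h)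
          exact .inr ⟨heq, by omega⟩
    obtain ⟨w, hw⟩ := key _ _ (hlab v) rfl rfl
    exact ⟨w, fun _ => hw⟩
  choose p₀ hp₀ using hpar
  let p : V → V := fun v => if v = r then r else p₀ v
  have hp : ∀ {v}, v ≠ r → p v = p₀ v := fun h => if_neg h
  let ρ : V → ℕ ×ₗ ℕ := fun v => toLex (ℓ v, δ v)
  have hρ : ∀ v, v ≠ r → ρ (p v) < ρ v := by
    intro v hv
    rw [hp hv]
    simp only [ρ]
    rw [Prod.Lex.toLex_lt_toLex]
    exact (hp₀ v hv).1
  have hstep : ∀ v, ℓ (p v) ≤ ℓ v ∧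
      (Even (ℓ v) → Reaches G (p v) v) ∧ (¬ Even (ℓ v) → Reaches G v (p v)) := by
    intro v
    by_cases hv : v = r
    · have : p v = v := by simp [p, hv]
      rw [this]
      exact ⟨le_rfl, fun _ => .refl _ _, fun _ => .refl _ _⟩
    · rw [hp hv]
      obtain ⟨h1, h2⟩ := hp₀ v hv
      refine ⟨by omega, fun h => ?_, fun h => ?_⟩
      · exact .of_adj (h2.resolve_right fun h' => h'.1 h).2
      · exact .of_adj (h2.resolve_left fun h' => h h'.1).2
  have hiter : ∀ m v, ℓ (p^[m] v) ≤ ℓ v := by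
    intro m
    induction m with
    | zero => exact fun v => le_rfl
    | succ m ih => exact fun v => (ih (p v)).trans (hstep v).1
  -- Layers never increase towards the root, so all parents in between lie in the same layer and
  -- their tree edges point the same way.
  have hchain : ∀ m v, ℓ (p^[m] v) = ℓ v → Reaches G (p^[m] v) v ∨ Reaches G v (p^[m] v) := by
    intro m v hv
    have : (Even (ℓ v) → Reaches G (p^[m] v) v) ∧ (¬ Even (ℓ v) → Reaches G v (p^[m] v)) := by
      induction m generalizing v with
      | zero => exact ⟨fun _ => .refl _ _, fun _ => .refl _ _⟩
      | succ m ih =>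
        rw [Function.iterate_succ_apply] at hv ⊢
        have h1 := hiter m (p v)
        have h2 := (hstep v).1
        have h3 : ℓ (p v) = ℓ v := by omega
        have h4 := ih (p v) (by omega)
        rw [h3] at h4
        exact ⟨fun h => (h4.1 h).trans ((hstep v).2.1 h), fun h => ((hstep v).2.2 h).trans (h4.2 h)⟩
    by_cases h : Even (ℓ v)
    exacts [.inl (this.1 h), .inr (this.2 h)]
  refine ⟨parentGraph r p, r, ℓ, ?_, parentGraph_isTree hρ, fun a b hab => ?_, ?_⟩
  · have hle : ∀ v, v ≠ r → G.Adj v (p v) ∨ G.Adj (p v) v := by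
      intro v hv
      rw [hp hv]
      rcases (hp₀ v hv).2 with h | h
      exacts [.inr h.2, .inl h.2]
    intro v w hvw
    rw [parentGraph, SimpleGraph.fromRel_adj] at hvw
    rw [Digraph.toSimpleGraphInclusive, SimpleGraph.fromRel_adj]
    refine ⟨hvw.1, ?_⟩
    rcases hvw.2 with ⟨hv, rfl⟩ | ⟨hw, rfl⟩
    exacts [hle v hv, (hle w hw).symm]
  · obtain ⟨m, h⟩ := (hlab a).exists_next_of_reaches (.inl hab)
    obtain ⟨m', h'⟩ := (hlab b).exists_next_of_reaches (.inr hab)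
    exact ⟨hℓ h, hℓ h'⟩
  · rintro S hS i x ⟨hxS, hxi⟩ y ⟨hyS, hyi⟩
    have hxy : ℓ x = ℓ y := Eq.trans hxi (Eq.symm hyi)
    obtain ⟨m, rfl | rfl⟩ := hS.exists_iterate hρ hxS hyS
    · exact (hchain m x hxy.symm).symm
    · exact hchain m y hxy

/-- A connected digraph has a rooted spanning tree such that all walks meeting a given monotone path
of the tree can be shortcut with few edges. -/
lemma exists_tree_shortcuts {V : Type*} [Finite V] {G : Digraph V} {k Λ : ℕ}
    (hΛ : ∀ n ≤ Nat.card V, LineSpanner k (2 * n) (Λ * n))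
    (hG : G.toSimpleGraphInclusive.Connected) :
    ∃ (T : SimpleGraph V) (r : V), T ≤ G.toSimpleGraphInclusive ∧ T.IsTree ∧
      ∀ S, IsMonotonePath T r S →
        ∃ E, Shortcuts k G S Set.univ E ∧ E.card ≤ 12 * Λ * Nat.card V := by
  classical
  have := Fintype.ofFinite V
  obtain ⟨T, r, ℓ, hT, hTt, hℓ, hS⟩ := exists_layering hG
  refine ⟨T, r, hT, hTt, fun S hSm => ?_⟩
  -- Only these vertices can be ends of a walk through layer `i`. Each vertex lies in at most three
  -- such sets; with the factor 4 per chain this gives 12.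
  let W : ℕ → Finset V := fun i => Finset.univ.filter fun v => i ≤ ℓ v + 1 ∧ ℓ v ≤ i + 1
  have hW : ∀ i, (W i).card ≤ Nat.card V := by
    intro i
    rw [Nat.card_eq_fintype_card]
    exact Finset.card_le_univ _
  have hE := fun i => exists_shortcuts_of_chain (hS S hSm i) (W i) (hΛ _ (hW i))
  choose E hEs hEc using hE
  refine ⟨(Finset.univ.image ℓ).biUnion E, ⟨?_, ?_⟩, ?_⟩
  · intro e he
    obtain ⟨i, _, hi⟩ := Finset.mem_biUnion.1 he
    exact (hEs i).1 e hi
  · intro a _ b _ q hq haq hqb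
    have h1 := hℓ _ _ haq
    have h2 := hℓ _ _ hqb
    refine ((hEs (ℓ q)).2 a ?_ b ?_ q ⟨hq, rfl⟩ haq hqb).mono
      (ofEdges_mono (Finset.subset_biUnion_of_mem E (Finset.mem_image_of_mem ℓ (Finset.mem_univ q))))
    · simp only [W, Finset.coe_filter, Finset.mem_univ, true_and, Set.mem_ofPred_eq]
      omega
    · simp only [W, Finset.coe_filter, Finset.mem_univ, true_and, Set.mem_ofPred_eq]
      omega
  · have hsum : ∑ i ∈ Finset.univ.image ℓ, (W i).card ≤ Nat.card V * 3 := by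
      simp only [W, Finset.card_filter]
      rw [Finset.sum_comm, Nat.card_eq_fintype_card, ← Finset.card_univ, ← smul_eq_mul]
      refine Finset.sum_le_card_nsmul _ _ _ fun v _ => ?_
      rw [← Finset.card_filter]
      calc _ ≤ (Finset.Icc (ℓ v - 1) (ℓ v + 1)).card := Finset.card_le_card fun i hi => by
            simp only [Finset.mem_filter, Finset.mem_Icc] at hi ⊢
            omega
        _ ≤ 3 := by
            rw [Nat.card_Icc]
            omega
    calc _ ≤ ∑ i ∈ Finset.univ.image ℓ, 4 * (Λ * (W i).card) :=
          Finset.card_biUnion_le.trans (Finset.sum_le_sum fun i _ => hEc i)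
      _ = 4 * Λ * ∑ i ∈ Finset.univ.image ℓ, (W i).card := by
          rw [Finset.mul_sum]
          exact Finset.sum_congr rfl fun i _ => (mul_assoc _ _ _).symm
      _ ≤ 4 * Λ * (Nat.card V * 3) := Nat.mul_le_mul_left _ hsum
      _ = 12 * Λ * Nat.card V := by ring

lemma Shortcuts.biUnion {V : Type*} [DecidableEq V] {G : Digraph V} {k : ℕ} {P : Finset (Set V)}
    {E : Set V → Finset (V × V)} {W : Set V} (h : ∀ S ∈ P, Shortcuts k G S W (E S)) :
    Shortcuts k G (⋃₀ (P : Set (Set V))) W (P.biUnion E) := by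
  refine ⟨fun e he => ?_, fun a ha b hb q ⟨S, hS, hq⟩ haq hqb => ?_⟩
  · obtain ⟨S, hS, heS⟩ := Finset.mem_biUnion.1 he
    exact (h S hS).1 e heS
  · exact ((h S hS).2 a ha b hb q hq haq hqb).mono
      (ofEdges_mono (Finset.subset_biUnion_of_mem E hS))

/-! ### Divide and conquer -/

/-- `G` has a `k`-TC-spanner with at most `N` edges. -/
def HasSpanner {V : Type*} (k : ℕ) (G : Digraph V) (N : ℕ) : Prop :=
  ∃ E : Finset (V × V), (∀ e ∈ E, Reaches G e.1 e.2) ∧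
    (∀ a b, Reaches G a b → DistLE (ofEdges E) k a b) ∧ E.card ≤ N

lemma HasSpanner.mono {V : Type*} {k : ℕ} {G : Digraph V} {N N' : ℕ} (h : HasSpanner k G N)
    (hN : N ≤ N') : HasSpanner k G N' :=
  let ⟨E, h1, h2, h3⟩ := h
  ⟨E, h1, h2, h3.trans hN⟩

lemma HasSpanner.of_subsingleton {V : Type*} [Subsingleton V] (k : ℕ) (G : Digraph V) (N : ℕ) :
    HasSpanner k G N :=
  ⟨∅, by simp, fun a b _ => Subsingleton.elim a b ▸ DistLE.refl _ _ _, by simp⟩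

lemma HasSpanner.exists_isTCSpanner {V : Type*} {k : ℕ} {G : Digraph V} {N : ℕ}
    (h : HasSpanner k G N) : ∃ H : Digraph V, IsTCSpanner k G H ∧ numEdges H ≤ N := by
  obtain ⟨E, h1, h2, h3⟩ := h
  refine ⟨ofEdges E, ⟨fun a b hab => h1 _ hab, h2⟩, ?_⟩
  have : {e : V × V | (ofEdges E).Adj e.1 e.2} = (E : Set (V × V)) := rfl
  rwa [numEdges, this, Set.ncard_coe_finset]

/-- The digraph induced along a map. -/
def pullback {W V : Type*} (f : W → V) (G : Digraph V) : Digraph W where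
  Adj a b := G.Adj (f a) (f b)

/-- The vertices of a connected component, as a type. -/
abbrev ComponentVerts {W : Type*} {U : SimpleGraph W} (c : U.ConnectedComponent) : Type _ :=
  {x // x ∈ c}

/-- The inclusion of a component of an induced subgraph. -/
def componentVal {V : Type*} {U : SimpleGraph V} {X : Set V} (c : (U.induce X).ConnectedComponent)
    (x : ComponentVerts c) : V := x.1.1

lemma componentVal_injective {V : Type*} {U : SimpleGraph V} {X : Set V}
    (c : (U.induce X).ConnectedComponent) : Function.Injective (componentVal c) :=
  fun _ _ hxy => Subtype.ext (Subtype.ext hxy)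

/-- The hypothesis keeps every vertex of the walk out of `X`, and consecutive vertices are equal or
adjacent, so the component never changes. -/
lemma WalkOfLength.exists_component {V : Type*} {G : Digraph V} {X : Set V} :
    ∀ {m : ℕ} {a b : V} (_ : WalkOfLength G m a b)
      (_ : ∀ q ∈ X, Reaches G a q → ¬ Reaches G q b) (ha : a ∈ Xᶜ),
      ∃ y : ComponentVerts ((G.toSimpleGraphInclusive.induce Xᶜ).connectedComponentMk ⟨a, ha⟩),
        componentVal _ y = b ∧ WalkOfLength (pullback (componentVal _) G) m ⟨⟨a, ha⟩, rfl⟩ y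
  | 0, _, _, hab, _, ha => ⟨⟨⟨_, ha⟩, rfl⟩, hab, rfl⟩
  | m + 1, a, b, ⟨c, hac, hcb⟩, hX, ha => by
      have hc : c ∈ Xᶜ := fun hc => hX c hc (.of_adj hac) ⟨m, hcb⟩
      obtain ⟨y, hy, hw⟩ := hcb.exists_component
        (fun q hq hcq => hX q hq ((Reaches.of_adj hac).trans hcq)) hc
      have hcomp : (G.toSimpleGraphInclusive.induce Xᶜ).connectedComponentMk ⟨c, hc⟩ =
          (G.toSimpleGraphInclusive.induce Xᶜ).connectedComponentMk ⟨a, ha⟩ := by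
        by_cases hca : c = a
        · subst hca
          rfl
        · refine SimpleGraph.ConnectedComponent.sound (SimpleGraph.Adj.reachable ?_)
          rw [SimpleGraph.comap_adj, Digraph.toSimpleGraphInclusive, SimpleGraph.fromRel_adj]
          exact ⟨hca, .inr hac⟩
      refine ⟨⟨y.1, y.2.trans hcomp⟩, hy, ⟨⟨c, hc⟩, hcomp⟩, hac, ?_⟩
      exact hw.map (H := pullback (componentVal _) G) (fun x => ⟨x.1, x.2.trans hcomp⟩)
        fun _ _ h => h

/-- Shortcuts through a separator `X` and spanners of the components left by it make a spanner. -/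
lemma HasSpanner.of_separator {V : Type*} [Finite V] {k : ℕ} {G : Digraph V} {X : Set V}
    {E₀ : Finset (V × V)} (hE₀ : Shortcuts k G X Set.univ E₀) {N₀ : ℕ} (hN₀ : E₀.card ≤ N₀)
    {K : ℕ}
    (h : ∀ c : (G.toSimpleGraphInclusive.induce Xᶜ).ConnectedComponent,
      HasSpanner k (pullback (componentVal c) G) (K * Nat.card (ComponentVerts c))) :
    HasSpanner k G (N₀ + K * Nat.card V) := by
  classical
  have := Fintype.ofFinite (G.toSimpleGraphInclusive.induce Xᶜ).ConnectedComponent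
  choose E hE1 hE2 hE3 using h
  let E' : (G.toSimpleGraphInclusive.induce Xᶜ).ConnectedComponent → Finset (V × V) :=
    fun c => (E c).image fun e => (componentVal c e.1, componentVal c e.2)
  refine ⟨E₀ ∪ Finset.univ.biUnion E', ?_, ?_, ?_⟩
  · intro e he
    rcases Finset.mem_union.1 he with he | he
    · exact hE₀.1 e he
    · obtain ⟨c, _, he⟩ := Finset.mem_biUnion.1 he
      obtain ⟨e, hec, rfl⟩ := Finset.mem_image.1 he
      obtain ⟨m, hm⟩ := hE1 c e hec
      exact ⟨m, hm.map (componentVal c) fun _ _ h => h⟩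
  · intro a b hab
    by_cases hX : ∃ q ∈ X, Reaches G a q ∧ Reaches G q b
    · obtain ⟨q, hq, haq, hqb⟩ := hX
      exact (hE₀.2 a trivial b trivial q hq haq hqb).mono
        (ofEdges_mono Finset.subset_union_left)
    · push Not at hX
      obtain ⟨m, hm⟩ := hab
      have ha : a ∈ Xᶜ := fun ha => hX a ha (.refl _ _) ⟨m, hm⟩
      obtain ⟨y, rfl, hw⟩ := hm.exists_component hX ha
      refine (hE2 _ _ _ ⟨m, hw⟩).map (componentVal _) fun x z hxz => ?_
      exact Finset.mem_union_right _ (Finset.mem_biUnion.2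
        ⟨_, Finset.mem_univ _, Finset.mem_image.2 ⟨_, hxz, rfl⟩⟩)
  · have hcard : ∑ c : (G.toSimpleGraphInclusive.induce Xᶜ).ConnectedComponent,
        Nat.card (ComponentVerts c) ≤ Nat.card V := by
      rw [← Nat.card_sigma]
      refine Nat.card_le_card_of_injective (fun x => componentVal x.1 x.2) ?_
      rintro ⟨_, x, rfl⟩ ⟨_, y, rfl⟩ hxy
      obtain rfl : x = y := Subtype.ext hxy
      rfl
    have hE' : (Finset.univ.biUnion E').card ≤ K * Nat.card V := by
      refine Finset.card_biUnion_le.trans (le_trans ?_ (Nat.mul_le_mul_left K hcard))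
      rw [Finset.mul_sum]
      exact Finset.sum_le_sum fun c _ => Finset.card_image_le.trans (hE3 c)
    exact (Finset.card_union_le _ _).trans (Nat.add_le_add hN₀ hE')

lemma toSimpleGraphInclusive_pullback_component {V : Type*} {G : Digraph V} {X : Set V}
    (c : (G.toSimpleGraphInclusive.induce Xᶜ).ConnectedComponent) :
    (pullback (componentVal c) G).toSimpleGraphInclusive = c.toSimpleGraph := by
  ext x y
  have h : x ≠ y ↔ x.1.1 ≠ y.1.1 := by
    rw [Ne, Ne, Subtype.ext_iff, Subtype.ext_iff]
  change (x ≠ y ∧ _) ↔ (x.1.1 ≠ y.1.1 ∧ _)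
  rw [h]
  rfl

lemma MinorClosed.mem_component {F : GraphFamily.{u}} (hF : MinorClosed F) {V : Type u} [Finite V]
    {U : SimpleGraph V} (hU : U ∈ F V) {X : Set V} (c : (U.induce X).ConnectedComponent) :
    c.toSimpleGraph ∈ F (ComponentVerts c) := by
  refine hF V (ComponentVerts c) U _ hU ⟨fun w => {w.1.1}, fun w => ?_,
    fun w w' hww' => ?_, fun w w' h => ?_⟩
  · exact { preconnected := fun x y => Subsingleton.elim x y ▸ .refl _, nonempty := ⟨⟨_, rfl⟩⟩ }
  · rw [Set.disjoint_singleton]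
    exact fun h => hww' (Subtype.ext (Subtype.ext h))
  · exact ⟨_, rfl, _, rfl, h⟩

/-- Halving a path separable graph with few shortcut edges. -/
lemma HasSpanner.of_isPathSeparable {F : GraphFamily.{u}} (hF : MinorClosed F) {k Λ n K : ℕ}
    (hΛ : ∀ n' ≤ n, LineSpanner k (2 * n') (Λ * n'))
    (hsmall : ∀ (V : Type u) [Finite V] (G : Digraph V), G.toSimpleGraphInclusive ∈ F V →
      G.toSimpleGraphInclusive.Connected → Nat.card V ≤ n / 2 →
      HasSpanner k G (K * Nat.card V)) (s : ℕ) :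
    ∀ (V : Type u) [Finite V] (G : Digraph V), G.toSimpleGraphInclusive ∈ F V →
      G.toSimpleGraphInclusive.Connected → Nat.card V ≤ n →
      IsPathSeparable G.toSimpleGraphInclusive s (n / 2) →
      HasSpanner k G ((12 * Λ * s + K) * Nat.card V) := by
  classical
  induction s using Nat.strong_induction_on with
  | _ s ih =>
    intro V _ G hGF hGc hVn hsep
    obtain ⟨T, r, hT, hTt, hpath⟩ :=
      exists_tree_shortcuts (fun n' hn' => hΛ n' (hn'.trans hVn)) hGc
    have hP : ∀ P : Finset (Set V), (∀ S ∈ P, IsMonotonePath T r S) →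
        ∃ E, Shortcuts k G (⋃₀ (P : Set (Set V))) Set.univ E ∧
          E.card ≤ P.card * (12 * Λ * Nat.card V) := by
      intro P hP
      have : ∀ S, ∃ E, S ∈ P → Shortcuts k G S Set.univ E ∧ E.card ≤ 12 * Λ * Nat.card V := by
        intro S
        by_cases hS : S ∈ P
        · obtain ⟨E, hE⟩ := hpath S (hP S hS)
          exact ⟨E, fun _ => hE⟩
        · exact ⟨∅, fun h => absurd h hS⟩
      choose E hE using this
      exact ⟨P.biUnion E, Shortcuts.biUnion fun S hS => (hE S hS).1,
        Finset.card_biUnion_le_card_mul _ _ _ fun S hS => (hE S hS).2⟩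
    have hmem : ∀ (X : Set V) (c : (G.toSimpleGraphInclusive.induce Xᶜ).ConnectedComponent),
        (pullback (componentVal c) G).toSimpleGraphInclusive ∈ F (ComponentVerts c) ∧
          (pullback (componentVal c) G).toSimpleGraphInclusive.Connected := by
      intro X c
      rw [toSimpleGraphInclusive_pullback_component]
      exact ⟨hF.mem_component hGF c, c.connected_toSimpleGraph⟩
    rw [IsPathSeparable] at hsep
    rcases hsep T r hT hTt with ⟨P, hPc, hPm, hcomp⟩ | ⟨s', ⟨hs'0, hs's⟩, P, rfl, hPm, c, hcmax, hc⟩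
    · obtain ⟨E, hE, hEc⟩ := hP P hPm
      refine (HasSpanner.of_separator (K := K) hE hEc fun c =>
        hsmall _ _ (hmem _ c).1 (hmem _ c).2 ?_).mono ?_
      · exact hcomp c
      · calc P.card * (12 * Λ * Nat.card V) + K * Nat.card V
            ≤ s * (12 * Λ * Nat.card V) + K * Nat.card V :=
              Nat.add_le_add_right (Nat.mul_le_mul_right _ hPc) _
          _ = (12 * Λ * s + K) * Nat.card V := by ring
    · obtain ⟨E, hE, hEc⟩ := hP P hPm
      refine (HasSpanner.of_separator (K := 12 * Λ * (s - P.card) + K) hE hEc fun c' => ?_).mono ?_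
      · by_cases hcc : c' = c
        · subst hcc
          -- The threshold `n / 2` stays fixed while the largest component is cut further with the
          -- remaining budget of paths.
          refine ih _ (by omega) _ _ (hmem _ c').1 (hmem _ c').2 ?_ ?_
          · refine le_trans ?_ hVn
            exact Nat.card_le_card_of_injective _ (componentVal_injective c')
          · rw [toSimpleGraphInclusive_pullback_component]
            exact hc
        · refine (hsmall _ _ (hmem _ c').1 (hmem _ c').2 ?_).mono
            (Nat.mul_le_mul_right _ (Nat.le_add_left _ _))
          -- A component other than the chosen largest one has at most half of the vertices.
          have h1 : Nat.card (ComponentVerts c') ≤ Nat.card (ComponentVerts c) := hcmax c'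
          have h2 : Nat.card (ComponentVerts c) + Nat.card (ComponentVerts c') ≤ Nat.card V := by
            rw [← Nat.card_sum]
            refine Nat.card_le_card_of_injective
              (Sum.elim (componentVal c) (componentVal c')) ?_
            refine Function.Injective.sumElim (componentVal_injective c)
              (componentVal_injective c') fun x y hxy => hcc ?_
            have h3 : x.1 = y.1 := Subtype.ext hxy
            rw [← y.2, ← h3]
            exact x.2
          omega
      · have h4 : s = (s - P.card) + P.card := by omega
        generalize s - P.card = t at h4 ⊢
        subst h4
        apply le_of_eq
        ring

theorem HasSpanner.of_family {F : GraphFamily.{u}} (hF : MinorClosed F) {s : ℕ}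
    (hFs : FamilyPathSeparable F s) {k Λ n : ℕ}
    (hΛ : ∀ n' ≤ n, LineSpanner k (2 * n') (Λ * n')) :
    ∀ (V : Type u) [Finite V] (G : Digraph V), G.toSimpleGraphInclusive ∈ F V →
      G.toSimpleGraphInclusive.Connected → Nat.card V ≤ n →
      HasSpanner k G (12 * Λ * s * Nat.log 2 n * Nat.card V) := by
  induction n using Nat.strong_induction_on with
  | _ n ih =>
    intro V _ G hGF hGc hVn
    rcases le_or_gt (Nat.card V) 1 with h1 | h1
    · have := (Finite.card_le_one_iff_subsingleton).1 h1
      exact HasSpanner.of_subsingleton _ _ _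
    · have hsep := hFs V _ hGF hGc
      have hn : Nat.card V / 2 ≤ n / 2 := Nat.div_le_div_right hVn
      have hlog : Nat.log 2 (Nat.card V) = Nat.log 2 (Nat.card V / 2) + 1 :=
        Nat.log_of_one_lt_of_le (by omega) h1
      refine (HasSpanner.of_isPathSeparable hF (fun n' hn' => hΛ n' (hn'.trans hVn))
        (K := 12 * Λ * s * Nat.log 2 (Nat.card V / 2))
        (fun W _ G' h1' h2' h3' =>
          ih (Nat.card V / 2) (by omega) (fun n' hn' => hΛ n' (by omega)) W G' h1' h2' h3')
        s V G hGF hGc le_rfl hsep).mono (Nat.mul_le_mul_right _ ?_)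
      calc 12 * Λ * s + 12 * Λ * s * Nat.log 2 (Nat.card V / 2)
          = 12 * Λ * s * Nat.log 2 (Nat.card V) := by rw [hlog]; ring
        _ ≤ 12 * Λ * s * Nat.log 2 n := Nat.mul_le_mul_left _ (Nat.log_mono_right hVn)

/-- A digraph drawn from a path separable family has the spanner given by its line spanners. -/
theorem HasSpanner.of_drawnFrom {F : GraphFamily.{u}} (hF : MinorClosed F) {s : ℕ}
    (hFs : FamilyPathSeparable F s) {V : Type u} [Finite V] {k Λ : ℕ}
    (hΛ : ∀ n ≤ Nat.card V, LineSpanner k (2 * n) (Λ * n)) {G : Digraph V} (hG : DrawnFrom F G) :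
    HasSpanner k G (12 * Λ * s * Nat.log 2 (Nat.card V) * Nat.card V) := by
  have main : ∀ R : Digraph V, R.toSimpleGraphInclusive ∈ F V →
      HasSpanner k R (12 * Λ * s * Nat.log 2 (Nat.card V) * Nat.card V) := by
    intro R hR
    -- The empty separator splits a possibly disconnected graph into its components at no cost.
    have hE : Shortcuts k R ∅ Set.univ ∅ := ⟨by simp, by simp⟩
    refine (HasSpanner.of_separator hE (Finset.card_empty.le) fun c => ?_).mono
      (Nat.zero_add _).le
    refine HasSpanner.of_family hF hFs hΛ _ _ ?_ ?_ ?_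
    · rw [toSimpleGraphInclusive_pullback_component]
      exact hF.mem_component hR c
    · rw [toSimpleGraphInclusive_pullback_component]
      exact c.connected_toSimpleGraph
    · exact Nat.card_le_card_of_injective _ (componentVal_injective c)
  rcases hG with hG | ⟨R, ⟨hRG, _⟩, hR⟩
  · exact main G hG
  · have hreach : Reaches R = Reaches G := congrArg Digraph.Adj hRG
    obtain ⟨E, h1, h2, h3⟩ := main R hR
    rw [hreach] at h1 h2
    exact ⟨E, h1, h2, h3⟩

/-- The bound in terms of the Ackermann hierarchy, with a constant independent of the family. -/
theorem exists_spanner_of_drawnFrom (s k : ℕ) :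
    ∃ C : ℕ, ∀ F : GraphFamily.{u}, MinorClosed F → FamilyPathSeparable F s →
      ∀ (V : Type u) [Finite V] (G : Digraph V), DrawnFrom F G →
        ∀ j, 2 * Nat.card V ≤ ackRow (k + 2) j →
          ∃ H : Digraph V, IsTCSpanner (k + 2) G H ∧
            numEdges H ≤ C * (j + 1) * Nat.log 2 (Nat.card V) * Nat.card V := by
  obtain ⟨C, hC⟩ := exists_lineSpanner k
  refine ⟨24 * C * s, fun F hF hFs V _ G hG j hj => ?_⟩
  -- The line has an entry and an exit position for each vertex, which doubles its length and turns
  -- 12 into 24.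
  have hΛ : ∀ n ≤ Nat.card V, LineSpanner (k + 2) (2 * n) (2 * C * (j + 1) * n) := by
    intro n hn
    refine (hC j (2 * n) (by omega)).mono le_rfl (le_of_eq ?_)
    ring
  obtain ⟨H, hH, hHn⟩ := (HasSpanner.of_drawnFrom hF hFs hΛ hG).exists_isTCSpanner
  refine ⟨H, hH, hHn.trans (le_of_eq ?_)⟩
  ring

lemma le_ackRow_invAck (k n : ℕ) : n ≤ ackRow (k + 2) (invAck (k + 2) n) := by
  have h : {j | n ≤ ackRow (k + 2) j}.Nonempty :=
    ⟨n, Nat.lt_two_pow_self.le.trans (two_pow_le_ackRow k n)⟩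
  exact Nat.sInf_mem h

/-- Every row starts at 1 or 2. Positivity lets additive constants be absorbed into a multiple of
λ_k(n). -/
lemma one_le_invAck {k n : ℕ} (hn : 3 ≤ n) : 1 ≤ invAck (k + 2) n := by
  by_contra h
  have h1 := le_ackRow_invAck k n
  rw [show invAck (k + 2) n = 0 by omega] at h1
  have h2 := (ackRow_zero_pos k).2
  omega

end TCSpanner

theorem theoremF2 (s : ℕ) :
    (∃ C : ℝ, ∀ F : TCSpanner.GraphFamily.{u},
      TCSpanner.MinorClosed F → TCSpanner.FamilyPathSeparable F s →
      ∀ (V : Type u) [Fintype V] (G : Digraph V), TCSpanner.DrawnFrom F G →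
        ∃ H : Digraph V, TCSpanner.IsTCSpanner 2 G H ∧
          (TCSpanner.numEdges H : ℝ) ≤
            C * ((Fintype.card V : ℝ) * Real.logb 2 (Fintype.card V) ^ 2)) ∧
    (∀ k : ℕ, 2 ≤ k →
      ∃ C : ℝ, ∀ F : TCSpanner.GraphFamily.{u},
        TCSpanner.MinorClosed F → TCSpanner.FamilyPathSeparable F s →
        ∀ (V : Type u) [Fintype V] (G : Digraph V), TCSpanner.DrawnFrom F G →
          3 ≤ Fintype.card V →
          ∃ H : Digraph V, TCSpanner.IsTCSpanner k G H ∧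
            (TCSpanner.numEdges H : ℝ) ≤
              C * ((Fintype.card V : ℝ) * Real.logb 2 (Fintype.card V) *
                (TCSpanner.invAck k (Fintype.card V) : ℝ))) := by
  have hlogb : ∀ n : ℕ, (Nat.log 2 n : ℝ) ≤ Real.logb 2 n := fun n => by
    exact_mod_cast Real.natLog_le_logb n 2
  constructor
  · obtain ⟨C, hC⟩ := TCSpanner.exists_spanner_of_drawnFrom.{u} s 0
    refine ⟨C * 4, fun F hF hFs V _ G hG => ?_⟩
    -- One of the two extra units makes up for rounding the logarithm down, the other for the
    -- doubled line.
    obtain ⟨H, hH, hHn⟩ := hC F hF hFs V G hG (Nat.log 2 (Fintype.card V) + 2) (by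
      refine le_trans ?_ (TCSpanner.two_pow_le_ackRow 0 _)
      have := Nat.lt_pow_succ_log_self (b := 2) (by omega) (Fintype.card V)
      rw [Nat.card_eq_fintype_card, pow_succ]
      omega)
    refine ⟨H, hH, ?_⟩
    rw [Nat.card_eq_fintype_card] at hHn
    generalize Fintype.card V = n at hHn ⊢
    have hl := hlogb n
    have hle : C * (Nat.log 2 n + 2 + 1) * Nat.log 2 n * n ≤ C * 4 * (n * Nat.log 2 n ^ 2) := by
      -- For `n ≤ 1` both sides vanish; otherwise `log + 3 ≤ 4 * log`.
      rcases Nat.eq_zero_or_pos (Nat.log 2 n) with h | h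
      · simp [h]
      · calc C * (Nat.log 2 n + 2 + 1) * Nat.log 2 n * n
            ≤ C * (4 * Nat.log 2 n) * Nat.log 2 n * n :=
              Nat.mul_le_mul_right _ (Nat.mul_le_mul_right _ (Nat.mul_le_mul_left _ (by omega)))
          _ = C * 4 * (n * Nat.log 2 n ^ 2) := by ring
    have hcast : (TCSpanner.numEdges H : ℝ) ≤ C * 4 * (n * (Nat.log 2 n : ℝ) ^ 2) := by
      exact_mod_cast hHn.trans hle
    refine hcast.trans ?_
    gcongr
  · intro k hk
    obtain ⟨k, rfl⟩ := Nat.exists_eq_add_of_le' hk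
    obtain ⟨C, hC⟩ := TCSpanner.exists_spanner_of_drawnFrom.{u} s k
    refine ⟨C * 3, fun F hF hFs V _ G hG hV => ?_⟩
    -- One more index at least doubles the row, which pays for the doubled line. The constant 3 then
    -- comes from `j + 2 ≤ 3 * j`.
    obtain ⟨H, hH, hHn⟩ := hC F hF hFs V G hG (TCSpanner.invAck (k + 2) (Fintype.card V) + 1) (by
      have h1 := TCSpanner.le_ackRow_invAck k (Fintype.card V)
      have h2 := TCSpanner.two_mul_ackRow_le k (TCSpanner.invAck (k + 2) (Fintype.card V))
      rw [Nat.card_eq_fintype_card]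
      omega)
    refine ⟨H, hH, ?_⟩
    have hj := TCSpanner.one_le_invAck (k := k) hV
    rw [Nat.card_eq_fintype_card] at hHn
    generalize TCSpanner.invAck (k + 2) (Fintype.card V) = j at hj hHn ⊢
    generalize Fintype.card V = n at hHn ⊢
    have hl := hlogb n
    have hle : C * (j + 1 + 1) * Nat.log 2 n * n ≤ C * 3 * (n * Nat.log 2 n * j) :=
      calc C * (j + 1 + 1) * Nat.log 2 n * n ≤ C * (3 * j) * Nat.log 2 n * n :=
            Nat.mul_le_mul_right _ (Nat.mul_le_mul_right _ (Nat.mul_le_mul_left _ (by omega)))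
        _ = C * 3 * (n * Nat.log 2 n * j) := by ring
    have hcast : (TCSpanner.numEdges H : ℝ) ≤ C * 3 * (n * (Nat.log 2 n : ℝ) * j) := by
      exact_mod_cast hHn.trans hle
    refine hcast.trans ?_
    gcongr
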